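/- A partition of $n\ge 0$ is a finite multiset of positive integers (its parts) with sum $n$ (so $0$ has only the empty partition). For integers $m_1,m_2,m_0,n\ge 0$ let $st(m_1,m_2,m_0,n)$ be the number of partitions of $n$ whose parts are pairwise at least $3$ apart (in particular distinct), whose parts divisible by $3$ are pairwise at least $6$ apart, and which have exactly $m_i$ parts congruent to $i$ modulo $3$ for each $i=1,2,0$. Write $(x;q)_k=\prod_{j=1}^{k}(1-xq^{j-1})$. **Theorem.** As an identity of formal power series in $a,b,c,q$ with integer coefficients, $$\sum_{m_1,m_2,m_0,n\ge 0} st(m_1,m_2,m_0,n)\,a^{m_1}b^{m_2}c^{m_0}q^{n} =\sum_{n_{11},n_{12},n_{10},n_{21},n_{22}\ge 0} \frac{q^{E(n_{11},n_{12},n_{10},n_{21},n_{22})}\;a^{2n_{21}+n_{11}}\,b^{2n_{22}+n_{12}}\,c^{n_{10}}}{(q^3;q^3)_{n_{11}}(q^3;q^3)_{n_{12}}(q^3;q^3)_{n_{10}}(q^6;q^6)_{n_{21}}(q^6;q^6)_{n_{22}}},$$ where $$\begin{aligned}E(n_{11},n_{12},n_{10},n_{21},n_{22})={}&6n_{21}^2-n_{21}+6n_{22}^2+n_{22}+3n_{11}^2-2n_{11}+3n_{12}^2-n_{12}+3n_{10}^2+12n_{21}n_{22}\\&+6(n_{21}+n_{22})(n_{11}+n_{12}+n_{10})+3n_{11}n_{12}+3n_{11}n_{10}+3n_{12}n_{10},\end{aligned}$$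 and the five-fold series on the right converges coefficientwise. -/

import Mathlib

open scoped MvPowerSeries.WithPiTopology

namespace SchurMod3

/-- The finite `q`-Pochhammer symbol `(x; q)_n = ∏_{j=1}^{n} (1 - x q^{j-1})`. -/
def qPoch {R : Type*} [CommRing R] (x q : R) (n : ℕ) : R :=
  ∏ j ∈ Finset.range n, (1 - x * q ^ j)

/-- The partitions (into positive parts) whose parts are pairwise at least three apart (in
particular no part is repeated) and whose multiples of 3 are pairwise at least six apart. -/
def IsSchur {n : ℕ} (p : n.Partition) : Prop :=
  p.parts.Nodup ∧
    (∀ x ∈ p.parts, ∀ y ∈ p.parts, x < y → x + 3 ≤ y) ∧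
    (∀ x ∈ p.parts, ∀ y ∈ p.parts, 3 ∣ x → 3 ∣ y → x < y → x + 6 ≤ y)

/-- The number of parts of `p` that leave the remainder `i` on division by 3. -/
def partsMod {n : ℕ} (p : n.Partition) (i : ℕ) : ℕ :=
  (p.parts.filter (fun x => x % 3 = i)).card

/-- `st m₁ m₂ m₀ n` is the number of Schur partitions of `n` with exactly `mᵢ` parts congruent
to `i` modulo 3, for `i = 1, 2, 0`. -/
noncomputable def st (m₁ m₂ m₀ n : ℕ) : ℕ :=
  Nat.card {p : n.Partition //
    IsSchur p ∧ partsMod p 1 = m₁ ∧ partsMod p 2 = m₂ ∧ partsMod p 0 = m₀}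

/-- Formal power series with integer coefficients in four variables. They carry the topology of
coefficientwise convergence, with `ℤ` discrete. -/
abbrev Series : Type := MvPowerSeries (Fin 4) ℤ

noncomputable def a : Series := MvPowerSeries.X 0
noncomputable def b : Series := MvPowerSeries.X 1
noncomputable def c : Series := MvPowerSeries.X 2
noncomputable def q : Series := MvPowerSeries.X 3

/-- The formal series `∑ st(m₁, m₂, m₀, n) a^{m₁} b^{m₂} c^{m₀} q^n`, given by its coefficients. -/
noncomputable def stSeries : Series :=
  fun d : Fin 4 →₀ ℕ => (st (d 0) (d 1) (d 2) (d 3) : ℤ)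

/-- `stSeries` is the sum of its monomials. -/
theorem hasSum_stSeries :
    HasSum (fun d : Fin 4 →₀ ℕ => (st (d 0) (d 1) (d 2) (d 3) : Series)
      * a ^ d 0 * b ^ d 1 * c ^ d 2 * q ^ d 3) stSeries := by
  convert MvPowerSeries.WithPiTopology.hasSum_of_monomials_self stSeries using 2 with d
  have h : MvPowerSeries.coeff d stSeries = (st (d 0) (d 1) (d 2) (d 3) : ℤ) := rfl
  have hd : d = Finsupp.single 0 (d 0) + Finsupp.single 1 (d 1) + Finsupp.single 2 (d 2)
      + Finsupp.single 3 (d 3) := by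
    ext i
    fin_cases i <;> simp
  have hC : (st (d 0) (d 1) (d 2) (d 3) : Series)
      = MvPowerSeries.monomial 0 (st (d 0) (d 1) (d 2) (d 3) : ℤ) := by
    rw [MvPowerSeries.monomial_zero_eq_C_apply]
    simp
  rw [h, hC]
  simp only [a, b, c, q, MvPowerSeries.X_pow_eq, MvPowerSeries.monomial_mul_monomial, mul_one,
    zero_add, ← hd]

/-- The reciprocal of a power series with constant coefficient 1. -/
noncomputable def recip (f : Series) : Series := MvPowerSeries.invOfUnit f 1

/-- The exponent of `q`. Each of the subtractions is of a natural number from a larger one. -/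
def qExp (n₁₁ n₁₂ n₁₀ n₂₁ n₂₂ : ℕ) : ℕ :=
  (6 * n₂₁ ^ 2 - n₂₁) + (6 * n₂₂ ^ 2 + n₂₂) + (3 * n₁₁ ^ 2 - 2 * n₁₁) + (3 * n₁₂ ^ 2 - n₁₂)
    + 3 * n₁₀ ^ 2 + 12 * n₂₁ * n₂₂ + 6 * (n₂₁ + n₂₂) * (n₁₁ + n₁₂ + n₁₀)
    + 3 * n₁₁ * n₁₂ + 3 * n₁₁ * n₁₀ + 3 * n₁₂ * n₁₀

/-- The subtractions in `qExp` do not truncate. -/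
theorem qExp_cast (n₁₁ n₁₂ n₁₀ n₂₁ n₂₂ : ℕ) :
    (qExp n₁₁ n₁₂ n₁₀ n₂₁ n₂₂ : ℤ) =
      6 * (n₂₁ : ℤ) ^ 2 - n₂₁ + 6 * n₂₂ ^ 2 + n₂₂ + 3 * n₁₁ ^ 2 - 2 * n₁₁ + 3 * n₁₂ ^ 2 - n₁₂
        + 3 * n₁₀ ^ 2 + 12 * n₂₁ * n₂₂ + 6 * (n₂₁ + n₂₂) * (n₁₁ + n₁₂ + n₁₀)
        + 3 * n₁₁ * n₁₂ + 3 * n₁₁ * n₁₀ + 3 * n₁₂ * n₁₀ := by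
  have h1 : n₂₁ ≤ 6 * n₂₁ ^ 2 := by nlinarith [Nat.le_self_pow two_ne_zero n₂₁]
  have h2 : 2 * n₁₁ ≤ 3 * n₁₁ ^ 2 := by nlinarith [Nat.le_self_pow two_ne_zero n₁₁]
  have h3 : n₁₂ ≤ 3 * n₁₂ ^ 2 := by nlinarith [Nat.le_self_pow two_ne_zero n₁₂]
  unfold qExp
  push_cast [Nat.cast_sub h1, Nat.cast_sub h2, Nat.cast_sub h3]
  ring

/-- The denominator `(q³;q³)_{n₁₁} (q³;q³)_{n₁₂} (q³;q³)_{n₁₀} (q⁶;q⁶)_{n₂₁} (q⁶;q⁶)_{n₂₂}`. -/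
noncomputable def den (n₁₁ n₁₂ n₁₀ n₂₁ n₂₂ : ℕ) : Series :=
  qPoch (q ^ 3) (q ^ 3) n₁₁ * qPoch (q ^ 3) (q ^ 3) n₁₂ * qPoch (q ^ 3) (q ^ 3) n₁₀
    * qPoch (q ^ 6) (q ^ 6) n₂₁ * qPoch (q ^ 6) (q ^ 6) n₂₂

/-- The denominator really is inverted by `recip`. -/
theorem den_mul_recip (n₁₁ n₁₂ n₁₀ n₂₁ n₂₂ : ℕ) :
    den n₁₁ n₁₂ n₁₀ n₂₁ n₂₂ * recip (den n₁₁ n₁₂ n₁₀ n₂₁ n₂₂) = 1 := by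
  apply MvPowerSeries.mul_invOfUnit
  simp [den, qPoch, map_prod, q]

/-- The general term of the five-fold series. -/
noncomputable def term (n₁₁ n₁₂ n₁₀ n₂₁ n₂₂ : ℕ) : Series :=
  q ^ qExp n₁₁ n₁₂ n₁₀ n₂₁ n₂₂ * recip (den n₁₁ n₁₂ n₁₀ n₂₁ n₂₂)
    * a ^ (2 * n₂₁ + n₁₁) * b ^ (2 * n₂₂ + n₁₂) * c ^ n₁₀

end SchurMod3

namespace SchurMod3

open Finset

/-! Fix the numbers `i`, `j`, `k` of parts congruent to 1, 2, 0 mod 3, and let `G_t` be the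
generating function in `q` of the corresponding Schur sets with all elements `≥ t`. Deciding whether
1, 2, 3 is the least element expresses `G_1 - G_2`, `G_2 - G_3`, `G_3 - G_4` through sets with one
element fewer, and translation by 3 gives `G_4 = q^{3(i+j+k)} G_1`. By induction on `i + j + k` this
forces the triple product `G_1 = q^{schurExp i j k} / ((q³;q³)_i (q³;q³)_j (q³;q³)_k)`
(`sumGF_schurSets_eq`).

The five-fold series refines this product. From `1/(z;x)_∞ = (-z;x)_∞ / (z²;x²)_∞`, the coefficient
of `z^n` gives `1/(x;x)_n = ∑_{m+2r=n} x^{m(m-1)/2} / ((x;x)_m (x²;x²)_r)` (`sum_addDoublePairs`).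
Applied with `x = q³` to the factors of index `i` and `j`, it produces exactly the exponent `qExp`
(`qExp_eq`). For fixed degrees in `a`, `b`, `c` only finitely many terms contribute, whence the
convergence. -/

/-- Sets of integers `≥ t` that are pairwise at least three apart and whose multiples of 3 are
pairwise at least six apart. -/
def IsSchurSet (t : ℕ) (S : Finset ℕ) : Prop :=
  (∀ x ∈ S, t ≤ x) ∧ (∀ x ∈ S, ∀ y ∈ S, x < y → x + 3 ≤ y) ∧
    (∀ x ∈ S, ∀ y ∈ S, 3 ∣ x → 3 ∣ y → x < y → x + 6 ≤ y)

/-- The Schur sets of integers `≥ t` with `i`, `j`, `k` elements congruent to 1, 2, 0 mod 3. -/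
def schurSets (t i j k : ℕ) : Set (Finset ℕ) :=
  {S | IsSchurSet t S ∧ #{x ∈ S | x % 3 = 1} = i ∧ #{x ∈ S | x % 3 = 2} = j ∧
    #{x ∈ S | x % 3 = 0} = k}

/-! ### Generating functions of families of finite sets -/

/-- The generating function of a family of finite sets by their sums. -/
noncomputable def sumGF (A : Set (Finset ℕ)) : PowerSeries ℤ :=
  PowerSeries.mk fun n => ({S ∈ A | ∑ x ∈ S, x = n}.ncard : ℤ)

theorem finite_setOf_sum_eq (A : Set (Finset ℕ)) (n : ℕ) :
    {S ∈ A | ∑ x ∈ S, x = n}.Finite := by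
  refine (Finset.finite_toSet (Finset.range (n + 1)).powerset).subset fun S hS => ?_
  have hS' : ∑ x ∈ S, x = n := hS.2
  simp only [coe_powerset, Set.mem_preimage, Set.mem_powerset_iff, coe_subset]
  intro x hx
  have := Finset.single_le_sum (f := fun x : ℕ => x) (fun _ _ => Nat.zero_le _) hx
  simp only [mem_range]
  omega

theorem sumGF_union {A B : Set (Finset ℕ)} (h : Disjoint A B) :
    sumGF (A ∪ B) = sumGF A + sumGF B := by
  ext n
  simp only [sumGF, PowerSeries.coeff_mk, map_add]
  rw [← Nat.cast_add, ← Set.ncard_union_eq _ (finite_setOf_sum_eq A n) (finite_setOf_sum_eq B n)]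
  · congr 2
    ext S
    simp only [Set.mem_ofPred_eq, Set.mem_union]
    tauto
  · exact h.mono (fun S hS => hS.1) (fun S hS => hS.1)

theorem sumGF_image {A : Set (Finset ℕ)} {f : Finset ℕ → Finset ℕ} {w : ℕ} (hf : Set.InjOn f A)
    (hw : ∀ S ∈ A, ∑ x ∈ f S, x = ∑ x ∈ S, x + w) :
    sumGF (f '' A) = PowerSeries.X ^ w * sumGF A := by
  ext n
  simp only [sumGF, PowerSeries.coeff_mk, PowerSeries.coeff_X_pow_mul']
  split_ifs with h
  · rw [← Set.InjOn.ncard_image (s := {S ∈ A | ∑ x ∈ S, x = n - w})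
      (hf.mono fun S hS => hS.1)]
    congr 2
    ext S
    simp only [Set.mem_ofPred_eq, Set.mem_image]
    constructor
    · rintro ⟨⟨T, hT, rfl⟩, hn⟩
      exact ⟨T, ⟨hT, by have := hw T hT; omega⟩, rfl⟩
    · rintro ⟨T, ⟨hT, hn⟩, rfl⟩
      exact ⟨⟨T, hT, rfl⟩, by have := hw T hT; omega⟩
  · rw [Nat.cast_eq_zero, Set.ncard_eq_zero (finite_setOf_sum_eq _ n)]
    ext S
    simp only [Set.mem_ofPred_eq, Set.mem_image, Set.mem_empty_iff_false, iff_false]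
    rintro ⟨⟨T, hT, rfl⟩, hn⟩
    have := hw T hT
    omega

/-! ### Recurrences from the least element -/

theorem IsSchurSet.notMem {t u : ℕ} {S : Finset ℕ} (h : IsSchurSet u S) (hu : t < u) : t ∉ S :=
  fun ht => absurd (h.1 t ht) (by omega)

/-- The bound `u` encodes both gap conditions next to `t`. If `3 ∣ t`, the value `t + 3` is a
multiple of 3 too close to `t`, so the rest starts at `t + 4`; the next multiple of 3 is then `t +
6`, which is allowed. -/
theorem isSchurSet_iff {t u : ℕ} (hu : u = if 3 ∣ t then t + 4 else t + 3) (S : Finset ℕ) :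
    IsSchurSet t S ↔ IsSchurSet (t + 1) S ∨ ∃ T, IsSchurSet u T ∧ insert t T = S := by
  constructor
  · intro h
    by_cases ht : t ∈ S
    · refine Or.inr ⟨S.erase t, ⟨fun x hx => ?_, fun x hx y hy => h.2.1 x (mem_of_mem_erase hx) y
        (mem_of_mem_erase hy), fun x hx y hy => h.2.2 x (mem_of_mem_erase hx) y
        (mem_of_mem_erase hy)⟩, insert_erase ht⟩
      have hx' := mem_of_mem_erase hx
      have h0 := ne_of_mem_erase hx
      have h1 := h.1 x hx'
      have h2 := h.2.1 t ht x hx' (by omega)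
      have h3 := h.2.2 t ht x hx'
      split_ifs at hu <;> omega
    · refine Or.inl ⟨fun x hx => ?_, h.2⟩
      have h1 := h.1 x hx
      have : x ≠ t := fun e => ht (e ▸ hx)
      omega
  · rintro (h | ⟨T, h, rfl⟩)
    · exact ⟨fun x hx => by have := h.1 x hx; omega, h.2⟩
    · have hge : ∀ x ∈ T, t + 3 ≤ x ∧ (3 ∣ t → t + 4 ≤ x) := fun x hx => by
        have := h.1 x hx
        split_ifs at hu <;> omega
      refine ⟨fun x hx => ?_, fun x hx y hy => ?_, fun x hx y hy => ?_⟩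
      · rcases mem_insert.1 hx with rfl | hx
        · exact le_rfl
        · have := hge x hx
          omega
      · rcases mem_insert.1 hx with hx | hx <;> rcases mem_insert.1 hy with hy | hy
        · omega
        · have := hge y hy
          omega
        · have := hge x hx
          omega
        · exact h.2.1 x hx y hy
      · rcases mem_insert.1 hx with hx | hx <;> rcases mem_insert.1 hy with hy | hy
        · omega
        · have := hge y hy
          omega
        · have := hge x hx
          omega
        · exact h.2.2 x hx y hy

/-- Removal of a possible least element `t`. -/
theorem sumGF_eq_add {t u : ℕ} (hu : u = if 3 ∣ t then t + 4 else t + 3) {A B C : Set (Finset ℕ)}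
    (hA : ∀ S ∈ A, IsSchurSet t S) (hB : ∀ S, S ∈ B ↔ S ∈ A ∧ IsSchurSet (t + 1) S)
    (hC : ∀ S, S ∈ C ↔ IsSchurSet u S ∧ insert t S ∈ A) :
    sumGF A = sumGF B + PowerSeries.X ^ t * sumGF C := by
  have htu : t < u := by split_ifs at hu <;> omega
  have hCt : ∀ S ∈ C, t ∉ S := fun S hS => ((hC S).1 hS).1.notMem htu
  rw [← sumGF_image (A := C) (f := insert t) (w := t), ← sumGF_union]
  · congr 1
    ext S
    simp only [Set.mem_union, Set.mem_image, hB, hC]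
    constructor
    · intro h
      rcases (isSchurSet_iff hu S).1 (hA S h) with h1 | ⟨T, hT, rfl⟩
      · exact Or.inl ⟨h, h1⟩
      · exact Or.inr ⟨T, ⟨hT, h⟩, rfl⟩
    · rintro (h | ⟨T, h, rfl⟩)
      exacts [h.1, h.2]
  · rw [Set.disjoint_left]
    rintro S hS ⟨T, -, rfl⟩
    exact ((hB _).1 hS).2.notMem (Nat.lt_succ_self t) (mem_insert_self t T)
  · intro S hS T hT h
    rw [← erase_insert (hCt S hS), ← erase_insert (hCt T hT), h]
  · intro S hS
    rw [sum_insert (hCt S hS), add_comm]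

theorem IsSchurSet.mono {t u : ℕ} (htu : t ≤ u) {S : Finset ℕ} (h : IsSchurSet u S) :
    IsSchurSet t S :=
  ⟨fun x hx => htu.trans (h.1 x hx), h.2⟩

theorem sumGF_schurSets_one_succ (i j k : ℕ) :
    sumGF (schurSets 1 (i + 1) j k)
      = sumGF (schurSets 2 (i + 1) j k) + PowerSeries.X ^ 1 * sumGF (schurSets 4 i j k) := by
  refine sumGF_eq_add (u := 4) (by norm_num) (fun S h => h.1)
    (fun S => ⟨fun h => ⟨⟨h.1.mono (by norm_num), h.2⟩, h.1⟩, fun h => ⟨h.2, h.1.2⟩⟩) fun S => ?_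
  have hins : IsSchurSet 4 S → IsSchurSet 1 (insert 1 S) :=
    fun h => (isSchurSet_iff (u := 4) (by norm_num) _).2 (Or.inr ⟨S, h, rfl⟩)
  constructor
  · rintro ⟨h, h'⟩
    refine ⟨h, hins h, ?_⟩
    simpa [filter_insert, h.notMem (t := 1) (by norm_num)] using h'
  · rintro ⟨h, -, h'⟩
    exact ⟨h, by simpa [filter_insert, h.notMem (t := 1) (by norm_num)] using h'⟩

theorem sumGF_schurSets_two_succ (i j k : ℕ) :
    sumGF (schurSets 2 i (j + 1) k)
      = sumGF (schurSets 3 i (j + 1) k) + PowerSeries.X ^ 2 * sumGF (schurSets 5 i j k) := by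
  refine sumGF_eq_add (u := 5) (by norm_num) (fun S h => h.1)
    (fun S => ⟨fun h => ⟨⟨h.1.mono (by norm_num), h.2⟩, h.1⟩, fun h => ⟨h.2, h.1.2⟩⟩) fun S => ?_
  have hins : IsSchurSet 5 S → IsSchurSet 2 (insert 2 S) :=
    fun h => (isSchurSet_iff (u := 5) (by norm_num) _).2 (Or.inr ⟨S, h, rfl⟩)
  constructor
  · rintro ⟨h, h'⟩
    refine ⟨h, hins h, ?_⟩
    simpa [filter_insert, h.notMem (t := 2) (by norm_num)] using h'
  · rintro ⟨h, -, h'⟩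
    exact ⟨h, by simpa [filter_insert, h.notMem (t := 2) (by norm_num)] using h'⟩

theorem sumGF_schurSets_three_succ (i j k : ℕ) :
    sumGF (schurSets 3 i j (k + 1))
      = sumGF (schurSets 4 i j (k + 1)) + PowerSeries.X ^ 3 * sumGF (schurSets 7 i j k) := by
  refine sumGF_eq_add (u := 7) (by norm_num) (fun S h => h.1)
    (fun S => ⟨fun h => ⟨⟨h.1.mono (by norm_num), h.2⟩, h.1⟩, fun h => ⟨h.2, h.1.2⟩⟩) fun S => ?_
  have hins : IsSchurSet 7 S → IsSchurSet 3 (insert 3 S) :=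
    fun h => (isSchurSet_iff (u := 7) (by norm_num) _).2 (Or.inr ⟨S, h, rfl⟩)
  constructor
  · rintro ⟨h, h'⟩
    refine ⟨h, hins h, ?_⟩
    simpa [filter_insert, h.notMem (t := 3) (by norm_num)] using h'
  · rintro ⟨h, -, h'⟩
    exact ⟨h, by simpa [filter_insert, h.notMem (t := 3) (by norm_num)] using h'⟩

theorem IsSchurSet.succ {t : ℕ} {S : Finset ℕ} (h : IsSchurSet t S) (ht : t ∉ S) :
    IsSchurSet (t + 1) S :=
  ⟨fun x hx => lt_of_le_of_ne (h.1 x hx) fun e => ht (e ▸ hx), h.2⟩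

theorem schurSets_succ_of_notMem {t i j k : ℕ} (h : ∀ S ∈ schurSets t i j k, t ∉ S) :
    schurSets (t + 1) i j k = schurSets t i j k :=
  Set.Subset.antisymm (fun _ hS => ⟨hS.1.mono (Nat.le_succ t), hS.2⟩)
    fun S hS => ⟨hS.1.succ (h S hS), hS.2⟩

theorem schurSets_one_zero (j k : ℕ) : schurSets 2 0 j k = schurSets 1 0 j k :=
  schurSets_succ_of_notMem fun S hS h => by
    have := hS.2.1
    rw [card_eq_zero, filter_eq_empty_iff] at this
    exact this h rfl

theorem schurSets_two_zero (i k : ℕ) : schurSets 3 i 0 k = schurSets 2 i 0 k :=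
  schurSets_succ_of_notMem fun S hS h => by
    have := hS.2.2.1
    rw [card_eq_zero, filter_eq_empty_iff] at this
    exact this h rfl

theorem schurSets_three_zero (i j : ℕ) : schurSets 4 i j 0 = schurSets 3 i j 0 :=
  schurSets_succ_of_notMem fun S hS h => by
    have := hS.2.2.2
    rw [card_eq_zero, filter_eq_empty_iff] at this
    exact this h rfl

theorem card_eq_of_mem_schurSets {t i j k : ℕ} {S : Finset ℕ} (h : S ∈ schurSets t i j k) :
    #S = i + j + k := by
  rw [card_eq_sum_card_fiberwise (f := fun x => x % 3) (t := range 3)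
    (fun x _ => by simpa using Nat.mod_lt x (by norm_num))]
  simp only [sum_range_succ, range_zero, sum_empty]
  rw [h.2.1, h.2.2.1, h.2.2.2]
  ring

/-! ### Translation by three -/

theorem isSchurSet_map_addRight (t : ℕ) (S : Finset ℕ) :
    IsSchurSet (t + 3) (S.map (addRightEmbedding 3)) ↔ IsSchurSet t S := by
  simp only [IsSchurSet, forall_mem_map, addRightEmbedding_apply, Nat.dvd_add_self_right,
    add_le_add_iff_right, add_lt_add_iff_right, Nat.add_right_comm _ 3]

theorem map_addRight_mem_schurSets {t i j k : ℕ} {S : Finset ℕ} :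
    S.map (addRightEmbedding 3) ∈ schurSets (t + 3) i j k ↔ S ∈ schurSets t i j k := by
  simp only [schurSets, Set.mem_ofPred_eq, isSchurSet_map_addRight, filter_map, card_map,
    Function.comp_def, addRightEmbedding_apply, Nat.add_mod_right]

theorem sumGF_schurSets_add_three (t i j k : ℕ) :
    sumGF (schurSets (t + 3) i j k)
      = PowerSeries.X ^ (3 * (i + j + k)) * sumGF (schurSets t i j k) := by
  rw [← sumGF_image (f := fun S => S.map (addRightEmbedding 3))]
  · congr 1
    ext S
    simp only [Set.mem_image]
    constructor
    · intro h
      have hS : (S.preimage (· + 3) (add_left_injective 3).injOn).map (addRightEmbedding 3) = S := by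
        ext x
        simp only [mem_map, mem_preimage, addRightEmbedding_apply]
        constructor
        · rintro ⟨y, hy, rfl⟩
          exact hy
        · intro hx
          have := h.1.1 x hx
          have hx3 : x - 3 + 3 = x := by omega
          exact ⟨x - 3, by rwa [hx3], hx3⟩
      exact ⟨_, map_addRight_mem_schurSets.1 (hS.symm ▸ h), hS⟩
    · rintro ⟨T, hT, rfl⟩
      exact map_addRight_mem_schurSets.2 hT
  · exact (Finset.map_injective _).injOn
  · intro S hS
    simp [sum_add_distrib, card_eq_of_mem_schurSets hS, mul_comm]

theorem sumGF_schurSets_zero (t : ℕ) : sumGF (schurSets t 0 0 0) = 1 := by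
  have : schurSets t 0 0 0 = {∅} := by
    ext S
    rw [Set.mem_singleton_iff]
    constructor
    · intro h
      simpa using card_eq_of_mem_schurSets h
    · rintro rfl
      simp [schurSets, IsSchurSet]
  ext n
  rw [this, PowerSeries.coeff_one, sumGF, PowerSeries.coeff_mk]
  split_ifs with h
  · rw [Nat.cast_eq_one, Set.ncard_eq_one]
    refine ⟨∅, ?_⟩
    ext S
    simp only [Set.mem_singleton_iff, Set.mem_ofPred_eq, and_iff_left_iff_imp]
    rintro rfl
    simp [h]
  · rw [Nat.cast_eq_zero, Set.ncard_eq_zero (finite_setOf_sum_eq _ n)]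
    ext S
    simp only [Set.mem_singleton_iff, Set.mem_ofPred_eq, Set.mem_empty_iff_false, iff_false]
    rintro ⟨rfl, h'⟩
    exact h h'.symm

/-! ### From partitions to sets -/

theorem st_eq_coeff (i j k n : ℕ) :
    (st i j k n : ℤ) = PowerSeries.coeff n (sumGF (schurSets 1 i j k)) := by
  rw [sumGF, PowerSeries.coeff_mk, st, ← Nat.card_coe_set_eq, Nat.cast_inj]
  have hcard {p : n.Partition} (hp : p.parts.Nodup) (r : ℕ) :
      #{x ∈ p.parts.toFinset | x % 3 = r} = partsMod p r := by
    rw [partsMod, ← Multiset.toFinset_filter, Multiset.toFinset_card_of_nodup (hp.filter _)]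
  refine Nat.card_congr (Equiv.ofBijective (fun p => ⟨p.1.parts.toFinset, ⟨⟨?_, ?_⟩, ?_⟩⟩) ⟨?_, ?_⟩)
  · obtain ⟨p, ⟨-, h2, h3⟩, -⟩ := p
    refine ⟨fun x hx => p.parts_pos (Multiset.mem_toFinset.1 hx), fun x hx y hy =>
      h2 x (Multiset.mem_toFinset.1 hx) y (Multiset.mem_toFinset.1 hy), fun x hx y hy =>
      h3 x (Multiset.mem_toFinset.1 hx) y (Multiset.mem_toFinset.1 hy)⟩
  · obtain ⟨p, ⟨h1, -⟩, h⟩ := p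
    simpa only [hcard h1] using h
  · obtain ⟨p, ⟨h1, -⟩, -⟩ := p
    have : ∑ x ∈ p.parts.toFinset, x = p.parts.sum := by
      rw [Finset.sum, Multiset.toFinset_val, h1.dedup, Multiset.map_id']
    exact this.trans p.parts_sum
  · rintro ⟨p, hp, hp'⟩ ⟨p', hq, hq'⟩ h
    have h' : p.parts.toFinset = p'.parts.toFinset := congrArg Subtype.val h
    have : p.parts = p'.parts := by
      rw [← hp.1.dedup, ← hq.1.dedup, ← Multiset.toFinset_val, h', Multiset.toFinset_val]
    exact Subtype.ext (Nat.Partition.ext this)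
  · rintro ⟨S, ⟨⟨h1, h2, h3⟩, h⟩, hn⟩
    have hval : S.val.toFinset = S := S.val_toFinset
    let p : n.Partition :=
      ⟨S.val, fun {x} hx => h1 x hx, by rw [← hn, Finset.sum, Multiset.map_id']⟩
    have hp : p.parts.Nodup := S.nodup
    refine ⟨⟨p, ⟨hp, h2, h3⟩, ?_⟩, Subtype.ext hval⟩
    simp only [← hcard hp]
    rw [show p.parts.toFinset = S from hval]
    exact h

/-! ### Splitting the reciprocal of a q-Pochhammer symbol -/

/-- The reciprocal of `(X^s; X^s)_n`. -/
noncomputable def qPochInv (s n : ℕ) : PowerSeries ℤ :=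
  PowerSeries.invOfUnit (qPoch (PowerSeries.X ^ s) (PowerSeries.X ^ s) n) 1

theorem qPoch_succ (s n : ℕ) :
    qPoch (PowerSeries.X ^ s : PowerSeries ℤ) (PowerSeries.X ^ s) (n + 1)
      = qPoch (PowerSeries.X ^ s) (PowerSeries.X ^ s) n * (1 - PowerSeries.X ^ (s * (n + 1))) := by
  rw [qPoch, prod_range_succ, qPoch, ← pow_succ', ← pow_mul]

theorem qPoch_mul_qPochInv {s : ℕ} (hs : s ≠ 0) (n : ℕ) :
    qPoch (PowerSeries.X ^ s) (PowerSeries.X ^ s) n * qPochInv s n = 1 :=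
  PowerSeries.mul_invOfUnit _ _ (by simp [qPoch, map_prod, hs])

theorem qPochInv_zero {s : ℕ} (hs : s ≠ 0) : qPochInv s 0 = 1 := by
  simpa [qPoch] using qPoch_mul_qPochInv hs 0

theorem one_sub_mul_qPochInv_succ {s : ℕ} (hs : s ≠ 0) (n : ℕ) :
    (1 - PowerSeries.X ^ (s * (n + 1))) * qPochInv s (n + 1) = qPochInv s n := by
  have h1 := qPoch_mul_qPochInv hs n
  have h2 := qPoch_mul_qPochInv hs (n + 1)
  rw [qPoch_succ] at h2
  linear_combination qPochInv s n * h2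
    - (1 - PowerSeries.X ^ (s * (n + 1))) * qPochInv s (n + 1) * h1

theorem eq_qPochInv {s : ℕ} (hs : s ≠ 0) {f : ℕ → PowerSeries ℤ} (h0 : f 0 = 1)
    (h : ∀ n, (1 - PowerSeries.X ^ (s * (n + 1))) * f (n + 1) = f n) (n : ℕ) :
    f n = qPochInv s n := by
  have key : qPoch (PowerSeries.X ^ s) (PowerSeries.X ^ s) n * f n = 1 := by
    induction n with
    | zero => simp [qPoch, h0]
    | succ n ih => rw [qPoch_succ, mul_assoc, h, ih]
  linear_combination qPochInv s n * key - f n * qPoch_mul_qPochInv hs n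

/-- The generating function in `z` of `X^(s * choose m 2) / (X^s; X^s)_m`. -/
noncomputable def distinctGF (s : ℕ) : PowerSeries (PowerSeries ℤ) :=
  PowerSeries.mk fun m => PowerSeries.X ^ (s * m.choose 2) * qPochInv s m

/-- The generating function in `z²` of `1 / (X^(2s); X^(2s))_r`. -/
noncomputable def evenGF (s : ℕ) : PowerSeries (PowerSeries ℤ) :=
  PowerSeries.mk fun t => if Even t then qPochInv (2 * s) (t / 2) else 0

/-- This is the functional equation of `(-z; X^s)_∞`: substituting `z X^s` for `z` removes the
factor `1 + z`. -/
theorem distinctGF_eq {s : ℕ} (hs : s ≠ 0) :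
    distinctGF s = (1 + PowerSeries.X) * PowerSeries.rescale (PowerSeries.X ^ s) (distinctGF s) := by
  ext1 m
  rw [add_mul, one_mul, map_add, PowerSeries.coeff_rescale]
  cases m with
  | zero => simp
  | succ m =>
    rw [PowerSeries.coeff_succ_X_mul, PowerSeries.coeff_rescale, distinctGF, PowerSeries.coeff_mk,
      PowerSeries.coeff_mk, Nat.choose_succ_succ' m 1, Nat.choose_one_right,
      ← one_sub_mul_qPochInv_succ hs m]
    ring

/-- This is the functional equation of `1/(z²; X^{2s})_∞`, checked on coefficients; the odd ones
vanish on both sides. -/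
theorem evenGF_mul {s : ℕ} (hs : s ≠ 0) :
    evenGF s * (1 - PowerSeries.X ^ 2) = PowerSeries.rescale (PowerSeries.X ^ s) (evenGF s) := by
  ext1 t
  rw [mul_sub, mul_one, map_sub, PowerSeries.coeff_rescale, PowerSeries.coeff_mul_X_pow']
  simp only [evenGF, PowerSeries.coeff_mk]
  rcases Nat.even_or_odd' t with ⟨r, rfl | rfl⟩
  · cases r with
    | zero => simp
    | succ r =>
      have h1 : 2 * (r + 1) - 2 = 2 * r := by omega
      have := one_sub_mul_qPochInv_succ (s := 2 * s) (by omega) r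
      simp only [even_two_mul, if_true, h1, Nat.mul_div_cancel_left _ (show 0 < 2 by norm_num),
        show 2 ≤ 2 * (r + 1) by omega, ← this]
      ring
  · have h1 : ¬ Even (2 * r + 1) := by simp
    have h2 : 2 ≤ 2 * r + 1 → ¬ Even (2 * r + 1 - 2) := by
      intro h
      rw [Nat.even_sub h]
      simp
    by_cases h : 2 ≤ 2 * r + 1
    · rw [if_neg h1, if_pos h, if_neg (h2 h), mul_zero, sub_zero]
    · simp [h1, h]

/-- Since `1 - z² = (1 - z)(1 + z)`, cancelling `1 + z` between the two functional equations leaves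
that of `1/(z; X^s)_∞`. -/
theorem one_sub_X_mul_distinctGF_mul_evenGF {s : ℕ} (hs : s ≠ 0) :
    (1 - PowerSeries.X) * (distinctGF s * evenGF s)
      = PowerSeries.rescale (PowerSeries.X ^ s) (distinctGF s * evenGF s) := by
  have hne : (1 + PowerSeries.X : PowerSeries (PowerSeries ℤ)) ≠ 0 := fun h => by
    simpa using congrArg PowerSeries.constantCoeff h
  refine mul_left_cancel₀ hne ?_
  rw [map_mul, ← evenGF_mul hs]
  linear_combination (evenGF s * (1 - PowerSeries.X ^ 2)) * distinctGF_eq hs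

theorem coeff_distinctGF_mul_evenGF {s : ℕ} (hs : s ≠ 0) (n : ℕ) :
    PowerSeries.coeff n (distinctGF s * evenGF s) = qPochInv s n := by
  refine eq_qPochInv (f := fun n => PowerSeries.coeff n (distinctGF s * evenGF s)) hs ?_
    (fun n => ?_) n
  · simp [distinctGF, evenGF, qPochInv_zero hs, qPochInv_zero (s := 2 * s) (by omega)]
  -- Comparing coefficients of `z^{n+1}` yields the recursion that determines `qPochInv`.
  · have h := congrArg (PowerSeries.coeff (n + 1)) (one_sub_X_mul_distinctGF_mul_evenGF hs)
    rw [sub_mul, one_mul, map_sub, PowerSeries.coeff_succ_X_mul, PowerSeries.coeff_rescale] at h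
    linear_combination h

/-- The pairs `(m, r)` with `m + 2 * r = n`. -/
def addDoublePairs (n : ℕ) : Finset (ℕ × ℕ) :=
  {p ∈ range (n + 1) ×ˢ range (n + 1) | 2 * p.2 + p.1 = n}

theorem mem_addDoublePairs {n : ℕ} {p : ℕ × ℕ} : p ∈ addDoublePairs n ↔ 2 * p.2 + p.1 = n := by
  simp only [addDoublePairs, mem_filter, mem_product, mem_range, and_iff_right_iff_imp]
  omega

theorem sum_addDoublePairs {s : ℕ} (hs : s ≠ 0) (n : ℕ) :
    ∑ p ∈ addDoublePairs n,
      PowerSeries.X ^ (s * p.1.choose 2) * qPochInv s p.1 * qPochInv (2 * s) p.2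
        = qPochInv s n := by
  rw [← coeff_distinctGF_mul_evenGF hs, PowerSeries.coeff_mul]
  simp only [distinctGF, evenGF, PowerSeries.coeff_mk, mul_ite, mul_zero]
  rw [← sum_filter]
  refine sum_bij' (fun p _ => (p.1, 2 * p.2)) (fun p _ => (p.1, p.2 / 2)) ?_ ?_ ?_ ?_ ?_
  · intro p hp
    rw [mem_addDoublePairs] at hp
    simp only [mem_filter, HasAntidiagonal.mem_antidiagonal, even_two_mul, and_true]
    omega
  · intro p hp
    simp only [mem_filter, HasAntidiagonal.mem_antidiagonal] at hp
    have := Nat.two_mul_div_two_of_even hp.2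
    rw [mem_addDoublePairs]
    simp only
    omega
  · intro p _
    simp
  · intro p hp
    have := Nat.two_mul_div_two_of_even (mem_filter.1 hp).2
    simp [this]
  · intro p _
    simp

/-! ### Closed form for the Schur sets -/

/-- The exponent of `X` in the closed form of the generating function of the Schur sets. -/
def schurExp (i j k : ℕ) : ℕ :=
  3 * i.choose 2 + i + 3 * j.choose 2 + 2 * j + 3 * k ^ 2 + 3 * i * j + 3 * i * k + 3 * j * k

/-- The closed form of the generating function of the Schur sets of positive integers. -/
noncomputable def schurGF (i j k : ℕ) : PowerSeries ℤ :=
  PowerSeries.X ^ schurExp i j k * (qPochInv 3 i * qPochInv 3 j * qPochInv 3 k)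

theorem one_sub_mul_schurGF_one (i j k : ℕ) :
    (1 - PowerSeries.X ^ (3 * (i + 1))) * schurGF (i + 1) j k
      = PowerSeries.X ^ (1 + 3 * (i + j + k)) * schurGF i j k := by
  have h := one_sub_mul_qPochInv_succ (s := 3) (by norm_num) i
  have he : schurExp (i + 1) j k = schurExp i j k + (1 + 3 * (i + j + k)) := by
    simp only [schurExp, Nat.choose_succ_succ' i 1, Nat.choose_one_right]
    ring
  rw [schurGF, schurGF, he, ← h]
  ring

theorem one_sub_mul_schurGF_two (i j k : ℕ) :
    (1 - PowerSeries.X ^ (3 * (j + 1))) * schurGF i (j + 1) k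
      = PowerSeries.X ^ (2 + 3 * (i + j + k)) * schurGF i j k := by
  have h := one_sub_mul_qPochInv_succ (s := 3) (by norm_num) j
  have he : schurExp i (j + 1) k = schurExp i j k + (2 + 3 * (i + j + k)) := by
    simp only [schurExp, Nat.choose_succ_succ' j 1, Nat.choose_one_right]
    ring
  rw [schurGF, schurGF, he, ← h]
  ring

theorem one_sub_mul_schurGF_three (i j k : ℕ) :
    (1 - PowerSeries.X ^ (3 * (k + 1))) * schurGF i j (k + 1)
      = PowerSeries.X ^ (3 + 3 * (i + j + 2 * k)) * schurGF i j k := by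
  have h := one_sub_mul_qPochInv_succ (s := 3) (by norm_num) k
  have he : schurExp i j (k + 1) = schurExp i j k + (3 + 3 * (i + j + 2 * k)) := by
    simp only [schurExp]
    ring
  rw [schurGF, schurGF, he, ← h]
  ring

/-- The formula for least element `≥ 2` is carried along because removing the element 2 leaves
elements `≥ 5`, a translate by 3 of that case. -/
theorem sumGF_schurSets_eq (N : ℕ) : ∀ i j k, i + j + k = N →
    sumGF (schurSets 1 i j k) = schurGF i j k ∧
      sumGF (schurSets 2 i j k) = PowerSeries.X ^ (3 * i) * schurGF i j k := by
  induction N with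
  | zero =>
    intro i j k h
    obtain ⟨⟨rfl, rfl⟩, rfl⟩ : (i = 0 ∧ j = 0) ∧ k = 0 := by omega
    simp [sumGF_schurSets_zero, schurGF, schurExp, qPochInv_zero]
  | succ N ih =>
    intro i j k h
    have h1 : sumGF (schurSets 1 i j k) - sumGF (schurSets 2 i j k)
        = (1 - PowerSeries.X ^ (3 * i)) * schurGF i j k := by
      cases i with
      | zero => simp [schurSets_one_zero]
      | succ i =>
        rw [sumGF_schurSets_one_succ, sumGF_schurSets_add_three 1, (ih i j k (by omega)).1,
          one_sub_mul_schurGF_one]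
        ring
    have h2 : sumGF (schurSets 2 i j k) - sumGF (schurSets 3 i j k)
        = PowerSeries.X ^ (3 * i) * ((1 - PowerSeries.X ^ (3 * j)) * schurGF i j k) := by
      cases j with
      | zero => simp [schurSets_two_zero]
      | succ j =>
        rw [sumGF_schurSets_two_succ, sumGF_schurSets_add_three 2, (ih i j k (by omega)).2,
          one_sub_mul_schurGF_two]
        ring
    have h3 : sumGF (schurSets 3 i j k) - sumGF (schurSets 4 i j k)
        = PowerSeries.X ^ (3 * (i + j)) * ((1 - PowerSeries.X ^ (3 * k)) * schurGF i j k) := by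
      cases k with
      | zero => simp [schurSets_three_zero]
      | succ k =>
        -- Removing 3 leaves elements `≥ 7`, so two translations by 3 lead back to elements `≥ 1`.
        rw [sumGF_schurSets_three_succ, sumGF_schurSets_add_three 4,
          sumGF_schurSets_add_three 1 i j k, (ih i j k (by omega)).1, one_sub_mul_schurGF_three]
        ring
    have hne : (1 - PowerSeries.X ^ (3 * (i + j + k)) : PowerSeries ℤ) ≠ 0 := fun h0 => by
      have := congrArg PowerSeries.constantCoeff h0
      simp [h] at this
    have key : sumGF (schurSets 1 i j k) = schurGF i j k := by
      refine mul_left_cancel₀ hne ?_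
      rw [sumGF_schurSets_add_three 1] at h3
      -- The right sides telescope to `1 - X^{3(i+j+k)}` times `schurGF i j k`.
      linear_combination h1 + h2 + h3
    exact ⟨key, by linear_combination key - h1⟩

/-! ### Matching the exponents -/

theorem qExp_eq (m₁ m₂ k r s : ℕ) :
    qExp m₁ m₂ k r s
      = schurExp (2 * r + m₁) (2 * s + m₂) k + 3 * m₁.choose 2 + 3 * m₂.choose 2 := by
  have hc (n : ℕ) : (n.choose 2 : ℚ) = n * (n - 1) / 2 := Nat.cast_choose_two ℚ n
  have h : ((qExp m₁ m₂ k r s : ℤ) : ℚ) = _ := congrArg _ (qExp_cast m₁ m₂ k r s)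
  rw [← Nat.cast_inj (R := ℚ), ← Int.cast_natCast, h, schurExp]
  push_cast [hc]
  ring

theorem sum_X_pow_qExp (i j k : ℕ) :
    ∑ x ∈ addDoublePairs i ×ˢ addDoublePairs j,
      PowerSeries.X ^ qExp x.1.1 x.2.1 k x.1.2 x.2.2 * (qPochInv 3 x.1.1 * qPochInv 3 x.2.1
        * qPochInv 3 k * qPochInv 6 x.1.2 * qPochInv 6 x.2.2)
      = schurGF i j k := by
  rw [schurGF, ← sum_addDoublePairs three_ne_zero i, ← sum_addDoublePairs three_ne_zero j,
    sum_mul_sum, ← sum_product', sum_mul, mul_sum]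
  refine sum_congr rfl fun x hx => ?_
  obtain ⟨h1, h2⟩ := mem_product.1 hx
  rw [mem_addDoublePairs] at h1 h2
  rw [qExp_eq, h1, h2]
  ring

/-! ### Transfer to four variables -/

/-- The embedding of the power series in one variable as the power series in `q`. -/
noncomputable def inQ : PowerSeries ℤ →ₐ[ℤ] Series :=
  PowerSeries.substAlgHom (PowerSeries.HasSubst.X (3 : Fin 4))

theorem inQ_X : inQ PowerSeries.X = q :=
  PowerSeries.substAlgHom_X _

theorem coeff_inQ (f : PowerSeries ℤ) (d : Fin 4 →₀ ℕ) :
    MvPowerSeries.coeff d (inQ f)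
      = if d = Finsupp.single 3 (d 3) then PowerSeries.coeff (d 3) f else 0 := by
  rw [inQ, PowerSeries.coe_substAlgHom, PowerSeries.coeff_subst (PowerSeries.HasSubst.X _),
    finsum_eq_single _ (d 3)]
  · simp [MvPowerSeries.coeff_X_pow]
  · intro n hn
    rw [MvPowerSeries.coeff_X_pow, if_neg, smul_zero]
    rintro rfl
    simp at hn

theorem inQ_qPochInv {s : ℕ} (hs : s ≠ 0) (n : ℕ) :
    qPoch (q ^ s) (q ^ s) n * inQ (qPochInv s n) = 1 := by
  have h := congrArg inQ (qPoch_mul_qPochInv hs n)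
  rwa [map_mul, map_one, qPoch, map_prod, prod_congr rfl fun j _ => by
    rw [map_sub, map_one, map_mul, map_pow, map_pow, map_pow, inQ_X]] at h

theorem recip_den (m₁ m₂ k r s : ℕ) :
    recip (den m₁ m₂ k r s) = inQ (qPochInv 3 m₁ * qPochInv 3 m₂ * qPochInv 3 k * qPochInv 6 r
      * qPochInv 6 s) := by
  refine left_inv_eq_right_inv ((mul_comm _ _).trans (den_mul_recip m₁ m₂ k r s)) ?_
  have h3 (n : ℕ) := inQ_qPochInv (s := 3) (by norm_num) n
  have h6 (n : ℕ) := inQ_qPochInv (s := 6) (by norm_num) n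
  calc _ = (qPoch (q ^ 3) (q ^ 3) m₁ * inQ (qPochInv 3 m₁))
        * (qPoch (q ^ 3) (q ^ 3) m₂ * inQ (qPochInv 3 m₂))
        * (qPoch (q ^ 3) (q ^ 3) k * inQ (qPochInv 3 k))
        * (qPoch (q ^ 6) (q ^ 6) r * inQ (qPochInv 6 r))
        * (qPoch (q ^ 6) (q ^ 6) s * inQ (qPochInv 6 s)) := by
          simp only [den, map_mul]
          ring
    _ = 1 := by simp only [h3, h6, mul_one]

theorem coeff_inQ_mul (f : PowerSeries ℤ) (i j k : ℕ) (d : Fin 4 →₀ ℕ) :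
    MvPowerSeries.coeff d (inQ f * a ^ i * b ^ j * c ^ k)
      = if i = d 0 ∧ j = d 1 ∧ k = d 2 then PowerSeries.coeff (d 3) f else 0 := by
  have hmon : inQ f * a ^ i * b ^ j * c ^ k = inQ f * MvPowerSeries.monomial
      (Finsupp.single 0 i + Finsupp.single 1 j + Finsupp.single 2 k) 1 := by
    simp only [a, b, c, MvPowerSeries.X_pow_eq, mul_assoc, MvPowerSeries.monomial_mul_monomial,
      mul_one, add_assoc]
  rw [hmon, MvPowerSeries.coeff_mul_monomial, mul_one, coeff_inQ]
  have hle : Finsupp.single 0 i + Finsupp.single 1 j + Finsupp.single 2 k ≤ d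
      ↔ i ≤ d 0 ∧ j ≤ d 1 ∧ k ≤ d 2 := by
    simp [Finsupp.le_def, Fin.forall_fin_succ]
  have heq (n : ℕ) : d - (Finsupp.single 0 i + Finsupp.single 1 j + Finsupp.single 2 k)
      = Finsupp.single 3 n ↔ d 0 ≤ i ∧ d 1 ≤ j ∧ d 2 ≤ k ∧ d 3 = n := by
    simp [Finsupp.ext_iff, Fin.forall_fin_succ, Nat.sub_eq_zero_iff_le]
  have h3 : (d - (Finsupp.single 0 i + Finsupp.single 1 j + Finsupp.single 2 k) : Fin 4 →₀ ℕ) 3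
      = d 3 := by
    simp
  rw [h3, ← ite_and]
  refine if_congr ?_ rfl rfl
  rw [hle, heq]
  omega

theorem term_eq (m₁ m₂ k r s : ℕ) :
    term m₁ m₂ k r s = inQ (PowerSeries.X ^ qExp m₁ m₂ k r s * (qPochInv 3 m₁ * qPochInv 3 m₂
      * qPochInv 3 k * qPochInv 6 r * qPochInv 6 s))
      * a ^ (2 * r + m₁) * b ^ (2 * s + m₂) * c ^ k := by
  rw [term, recip_den, map_mul inQ (_ ^ _), map_pow, inQ_X]

/-- The indices of the terms of degrees `i`, `j`, `k` in `a`, `b`, `c`. -/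
def termIndex (k : ℕ) : (ℕ × ℕ) × (ℕ × ℕ) ↪ ℕ × ℕ × ℕ × ℕ × ℕ where
  toFun x := (x.1.1, x.2.1, k, x.1.2, x.2.2)
  inj' := by
    rintro ⟨⟨_, _⟩, _, _⟩ ⟨⟨_, _⟩, _, _⟩ h
    simp_all

theorem termIndex_apply (k m₁ m₂ r s : ℕ) :
    termIndex k ((m₁, r), (m₂, s)) = (m₁, m₂, k, r, s) :=
  rfl

theorem hasSum_term :
    HasSum (fun n : ℕ × ℕ × ℕ × ℕ × ℕ => term n.1 n.2.1 n.2.2.1 n.2.2.2.1 n.2.2.2.2) stSeries := by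
  rw [MvPowerSeries.WithPiTopology.hasSum_iff_hasSum_coeff]
  intro d
  have hst : MvPowerSeries.coeff d stSeries = ∑ n ∈ (addDoublePairs (d 0) ×ˢ
      addDoublePairs (d 1)).map (termIndex (d 2)),
      MvPowerSeries.coeff d (term n.1 n.2.1 n.2.2.1 n.2.2.2.1 n.2.2.2.2) := by
    rw [show MvPowerSeries.coeff d stSeries = (st (d 0) (d 1) (d 2) (d 3) : ℤ) from rfl,
      st_eq_coeff, (sumGF_schurSets_eq _ _ _ _ rfl).1, ← sum_X_pow_qExp, map_sum,
      sum_map]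
    refine sum_congr rfl fun ⟨⟨m₁, r⟩, m₂, s⟩ hx => ?_
    obtain ⟨h1, h2⟩ := mem_product.1 hx
    rw [mem_addDoublePairs] at h1 h2
    rw [termIndex_apply, term_eq, coeff_inQ_mul, if_pos ⟨h1, h2, rfl⟩]
  rw [hst]
  -- A term outside the finite index set has the wrong degree in `a`, `b` or `c`, so its coefficient
  -- at `d` is zero.
  refine hasSum_sum_of_ne_finset_zero fun n hn => ?_
  obtain ⟨m₁, m₂, k, r, s⟩ := n
  simp only
  rw [term_eq, coeff_inQ_mul, if_neg]
  rintro ⟨h1, h2, h3⟩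
  refine hn (mem_map.2 ⟨((m₁, r), (m₂, s)), mem_product.2
    ⟨mem_addDoublePairs.2 h1, mem_addDoublePairs.2 h2⟩, ?_⟩)
  rw [termIndex_apply, h3]

end SchurMod3

theorem mainTheorem4 :
    HasSum
      (fun n : ℕ × ℕ × ℕ × ℕ × ℕ =>
        match n with
        | (n₁₁, n₁₂, n₁₀, n₂₁, n₂₂) => SchurMod3.term n₁₁ n₁₂ n₁₀ n₂₁ n₂₂)
      SchurMod3.stSeries :=
  SchurMod3.hasSum_term
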